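/- **Convergence of the sparsified NTK to the exact NTK.** Let $\sigma:\mathbb R\to\mathbb R$ be an activation function that is locally absolutely continuous, with $\sigma$ and its (almost everywhere defined) derivative $\sigma'$ square integrable for the standard Gaussian measure, and normalized so that $\mathbb E[\sigma(X)]=0$ and $\mathbb E[\sigma(X)^2]=1$ for $X\sim\mathcal N(0,1)$. Let $\mu=1-(\mathbb E[X\sigma(X)])^2$ be its coefficient of nonlinearity, and assume $\mu>0$ (i.e. $\sigma$ is not linear). For $\varphi\in\{\sigma,\sigma'\}$ and $\rho\in[-1,1]$ let $\hat\varphi(\rho)=\mathbb E[\varphi(U)\varphi(V)]$, where $(U,V)$ is a centred Gaussian vector with unit variances and covariance $\rho$ (equivalently, $U=w\cdot x$, $V=w\cdot y$ for a standard Gaussian vector $w$ and unit vectors $x,y$ with $x\cdot y=\rho$), and let $\hat\sigma^{(\ell)}$ be the $\ell$-fold composition of $\hat\sigma$. Let $\mathbf x_1,\dots,\mathbf x_n\in\mathbb R^d$ ($n\ge 1$) be unit vectors with $|\mathbf x_i\cdot\mathbf x_j|\le 1-\delta$ for all $i\ne j$, where $0<\delta\le 1$. Let $K$ be the $n\times n$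 neural tangent kernel (NTK) matrix of the fully-connected network with $L$ hidden layers and activation $\sigma$: with $\rho_{ij}=\mathbf x_i\cdot\mathbf x_j$, $$K_{ij}=\sum_{h=1}^{L+1}\hat\sigma^{(h-1)}(\rho_{ij})\prod_{h'=h}^{L}\widehat{\sigma'}\bigl(\hat\sigma^{(h'-1+\tau)}(\rho_{ij})\bigr),$$ where $\tau\in\{0,1\}$ selects one of the two layer-indexing conventions in use (the inner composition is $\hat\sigma^{(h'-1)}$ for $\tau=0$ and $\hat\sigma^{(h')}$ for $\tau=1$); the result holds for both. Assume the depth satisfies $$L\ \ge\ L_{\mathrm{conv}}:=\frac{8\log(n/\delta)}{\mu}.$$ Let $s:\mathbb N\to\mathbb N$ satisfy $s(n)=O(\log n)$, and let $\tilde K$ be any sparsification of $K$: it keeps the complete diagonal of $K$ and, in each row, an arbitrary set of at most $s(n)$ off-diagonal entries, all other entries being replaced by $0$ (no symmetry of the pattern is required). Then $K$ and $\tilde K$ are invertible and, in spectral norm, $$\frac{\|\tilde K^{-1}-K^{-1}\|}{\|K^{-1}\|}\ \le\ \frac{C}{n},$$ with a constant $C>0$ that depends at most on the function $s$, and not on $\sigma$,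 $n$, $d$, $\delta$, $L$, $\tau$, the data or the sparsity pattern; that is, the relative error is $O(1/n)$. -/

import Mathlib

open MeasureTheory ProbabilityTheory Filter Asymptotics
open scoped Matrix.Norms.L2Operator

noncomputable section

/-- Admissible normalized activation functions. The function `σ` is locally absolutely continuous
(so that its derivative `deriv σ` exists almost everywhere and `σ` is the integral of it; every
smooth or piecewise linear continuous `σ` is allowed), `σ` and its derivative are square integrable
for the standard Gaussian measure (so that all expectations below are finite), and
`E[σ(X)] = 0`, `E[σ(X)²] = 1` for `X ∼ N(0, 1)`. -/
structure IsNormalizedActivation (σ : ℝ → ℝ) : Prop where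
  absCont : ∀ a b : ℝ, AbsolutelyContinuousOnInterval σ a b
  memLp : MemLp σ 2 (gaussianReal 0 1)
  memLp_deriv : MemLp (deriv σ) 2 (gaussianReal 0 1)
  mean_zero : ∫ z, σ z ∂(gaussianReal 0 1) = 0
  second_moment : ∫ z, σ z ^ 2 ∂(gaussianReal 0 1) = 1

/-- The coefficient of nonlinearity `μ = 1 - (E[X σ(X)])²`, `X ∼ N(0, 1)`. -/
def nonlinCoeff (σ : ℝ → ℝ) : ℝ :=
  1 - (∫ z, z * σ z ∂(gaussianReal 0 1)) ^ 2

/-- The dual activation `φ̂ : [-1, 1] → ℝ` of `φ`, that is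
`φ̂ (x · y) = E[φ(w · x) φ(w · y)]` for unit vectors `x`, `y` and a standard Gaussian vector `w`.
It depends only on `ρ = x · y`, and it is computed here in the plane, with `w = (p.1, p.2)`,
`x = (1, 0)` and `y = (ρ, √(1 - ρ²))`. -/
def dualActivation (φ : ℝ → ℝ) (ρ : ℝ) : ℝ :=
  ∫ p : ℝ × ℝ, φ p.1 * φ (ρ * p.1 + √(1 - ρ ^ 2) * p.2)
    ∂((gaussianReal 0 1).prod (gaussianReal 0 1))

/-- The neural tangent kernel of the fully-connected network with `L` hidden layers, as a function
of the inner product `ρ` of two unit vectors: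
`∑_{h = 1}^{L + 1} σ̂^{(h - 1)}(ρ) ∏_{h' = h}^{L} (dual of σ')(σ̂^{(h' - 1 + τ)}(ρ))`,
where `σ̂^{(ℓ)}` is the `ℓ`-fold composition of `σ̂`. Two indexing conventions for the inner
composition are in use: `τ = 1` gives `σ̂^{(h')}`, and `τ = 0` gives `σ̂^{(h' - 1)}`. -/
def ntkFun (σ : ℝ → ℝ) (τ L : ℕ) (ρ : ℝ) : ℝ :=
  ∑ h ∈ Finset.Icc 1 (L + 1), (dualActivation σ)^[h - 1] ρ *
    ∏ h' ∈ Finset.Icc h L, dualActivation (deriv σ) ((dualActivation σ)^[h' - 1 + τ] ρ)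

/-- The NTK matrix `K` of a data set `x₁, …, xₙ`, with entries `K_ij = k(x_i, x_j)`. -/
def ntkMatrix (σ : ℝ → ℝ) (τ L : ℕ) {n d : ℕ} (x : Fin n → EuclideanSpace ℝ (Fin d)) :
    Matrix (Fin n) (Fin n) ℝ :=
  Matrix.of fun i j => ntkFun σ τ L (inner ℝ (x i) (x j))

/-- The sparsification of `K` that keeps the complete diagonal and, in row `i`, the entries in the
columns `S i`; all other entries are replaced by zero. -/
def sparsify {n : ℕ} (K : Matrix (Fin n) (Fin n) ℝ) (S : Fin n → Finset (Fin n)) :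
    Matrix (Fin n) (Fin n) ℝ :=
  Matrix.of fun i j => if j = i ∨ j ∈ S i then K i j else 0

/-- The convergence depth `L_conv = 8 log(n / δ) / μ`. -/
def convDepth (n : ℕ) (δ μ : ℝ) : ℝ :=
  8 * Real.log (n / δ) / μ

end

/-! Expand `σ` in normalized Hermite polynomials with coefficients `a_k`. By Mehler's formula `σ̂(ρ)
= ∑ a_k² ρ^k` (`hasSum_dualActivation`), where `a_0 = 0`, `∑ a_k² = 1` and `a_1² = 1 - μ`;
integration by parts gives the dual of `σ'` the coefficients `(k + 1) a_{k+1}²`. Hence `|σ̂(ρ)| ≤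
|ρ| (1 - μ + μ|ρ|)`, and `D`, the dual of `σ'` at 1, is at least `1 + μ`.

Let `r_l` be the absolute value of the `l`-th iterate of `σ̂` at `ρ`. Each layer shrinks `r_l / (1 -
r_l)` by a factor `1 + μ` (`abs_iterate_mul_pow_le`), and each derivative factor is at most `D / (1
+ μ) * (1 - r_{l+1}) / (1 - r_l)`, which telescopes (`prod_abs_dualActivation_deriv_le`). In every
summand of the kernel the two estimates combine to `(1 + μ)^(-L)` times the same summand at `ρ = 1`,
up to `|ρ| / (1 - |ρ|)` (`abs_ntkFun_le`).

At the convergence depth the off-diagonal entries are thus at most `κ / (4 n⁴)`, with `κ` the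
constant diagonal. Both matrices are then small perturbations of `κ • 1`, and the resolvent identity
finishes (`isUnit_and_norm_inv_sparsify_le`). -/

/-! ### Gaussian integration by parts. -/

open Polynomial in
lemma memLp_two_polynomial_eval (p : ℝ[X]) :
    MemLp (fun x => p.eval x) 2 (gaussianReal 0 1) := by
  have hpow : ∀ m : ℕ, Integrable (fun x : ℝ => x ^ m) (gaussianReal 0 1) := by
    intro m
    rcases eq_or_ne m 0 with rfl | hm
    · simp
    have h := (memLp_id_gaussianReal (μ := 0) (v := 1) (m : NNReal)).integrable_norm_pow'
    refine (integrable_norm_iff (by fun_prop)).1 (h.congr (ae_of_all _ fun x => ?_))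
    simp
  induction p using Polynomial.induction_on' with
  | add p q hp hq =>
    simp only [eval_add]
    exact hp.add hq
  | monomial n a =>
    simp only [eval_monomial]
    refine MemLp.const_mul ?_ a
    rw [memLp_two_iff_integrable_sq (by fun_prop)]
    simpa only [← pow_mul] using hpow (n * 2)

lemma integrable_mul_polynomial_eval {f : ℝ → ℝ} (hf : MemLp f 2 (gaussianReal 0 1))
    (p : Polynomial ℝ) : Integrable (fun x => f x * p.eval x) (gaussianReal 0 1) :=
  hf.integrable_mul (memLp_two_polynomial_eval p)

lemma integrable_gaussianPDFReal_mul {f : ℝ → ℝ} (hf : Integrable f (gaussianReal 0 1)) :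
    Integrable fun x => gaussianPDFReal 0 1 x * f x := by
  rw [gaussianReal_of_var_ne_zero 0 one_ne_zero,
    integrable_withDensity_iff_integrable_smul' (measurable_gaussianPDF 0 1)
      (ae_of_all _ fun _ => gaussianPDF_lt_top)] at hf
  simpa [toReal_gaussianPDF] using hf

/-- If an integrable `F` is a primitive of an integrable `G`, then `G` has integral zero. -/
lemma integral_eq_zero_of_intervalIntegral_eq_sub {F G : ℝ → ℝ} (hF : Integrable F)
    (hG : Integrable G) (h : ∀ a b, ∫ x in a..b, G x = F b - F a) : ∫ x, G x = 0 := by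
  -- Integrability of `G` gives `F` a limit at each end; as half-lines have infinite measure and `F`
  -- is integrable, the limit is 0.
  have htop : Tendsto F atTop (nhds 0) := by
    have h1 := intervalIntegral_tendsto_integral_Ioi 0 hG.integrableOn tendsto_id
    have h2 : Tendsto F atTop (nhds ((∫ x in Set.Ioi 0, G x) + F 0)) := by
      refine (h1.add_const (F 0)).congr fun b => ?_
      simp [h]
    have h3 := IntegrableAtFilter.eq_zero_of_tendsto
      (l := atTop) (f := F) (μ := volume) ⟨Set.univ, univ_mem, hF.integrableOn⟩ (fun s hs => by
        obtain ⟨b, hb⟩ := mem_atTop_sets.1 hs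
        rw [← top_le_iff, ← Real.volume_Ici (a := b)]
        exact measure_mono hb) h2
    rwa [h3] at h2
  have hbot : Tendsto F atBot (nhds 0) := by
    have h1 := intervalIntegral_tendsto_integral_Iic 0 hG.integrableOn tendsto_id
    have h2 : Tendsto F atBot (nhds (F 0 - ∫ x in Set.Iic 0, G x)) := by
      refine (h1.const_sub (F 0)).congr fun b => ?_
      simp [h]
    have h3 := IntegrableAtFilter.eq_zero_of_tendsto
      (l := atBot) (f := F) (μ := volume) ⟨Set.univ, univ_mem, hF.integrableOn⟩ (fun s hs => by
        obtain ⟨b, hb⟩ := mem_atBot_sets.1 hs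
        rw [← top_le_iff, ← Real.volume_Iic (a := b)]
        exact measure_mono hb) h2
    rwa [h3] at h2
  have h4 := intervalIntegral_tendsto_integral hG tendsto_neg_atTop_atBot tendsto_id
  have h5 : Tendsto (fun b : ℝ => F b - F (-b)) atTop (nhds (0 - 0)) :=
    htop.sub (hbot.comp tendsto_neg_atTop_atBot)
  rw [sub_zero] at h5
  exact tendsto_nhds_unique h4 (h5.congr fun b => by simp [h])

lemma hasDerivAt_gaussianPDFReal (x : ℝ) :
    HasDerivAt (gaussianPDFReal 0 1) (gaussianPDFReal 0 1 x * (-x)) x := by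
  have h : HasDerivAt (fun y : ℝ => -(y - 0) ^ 2 / (2 * ((1 : NNReal) : ℝ))) (-x) x := by
    have := (((hasDerivAt_id x).sub_const 0).pow 2).neg.div_const (2 * ((1 : NNReal) : ℝ))
    convert! this using 1
    simp
    ring
  have h2 := h.exp.const_mul (√(2 * Real.pi * ((1 : NNReal) : ℝ)))⁻¹
  rw [gaussianPDFReal_def]
  convert! h2 using 1
  ring

/-- Gaussian integration by parts against a polynomial. -/
lemma integral_deriv_mul_polynomial_gaussianReal {f : ℝ → ℝ}
    (hac : ∀ a b : ℝ, AbsolutelyContinuousOnInterval f a b)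
    (hf : MemLp f 2 (gaussianReal 0 1)) (hf' : MemLp (deriv f) 2 (gaussianReal 0 1))
    (p : Polynomial ℝ) :
    ∫ x, deriv f x * p.eval x ∂(gaussianReal 0 1)
      = ∫ x, f x * (Polynomial.X * p - p.derivative).eval x ∂(gaussianReal 0 1) := by
  -- With the density absorbed into `g`, the claim becomes the vanishing of the Lebesgue integral of
  -- `(f g)'`.
  set g : ℝ → ℝ := fun x => gaussianPDFReal 0 1 x * p.eval x with hg
  have hgd : ∀ x, HasDerivAt g
      (-(gaussianPDFReal 0 1 x * (Polynomial.X * p - p.derivative).eval x)) x := by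
    intro x
    convert! (hasDerivAt_gaussianPDFReal x).mul (p.hasDerivAt x) using 1
    simp
    ring
  have hgc : ContDiff ℝ 1 g := by
    have : ContDiff ℝ 1 (gaussianPDFReal 0 1) := by
      rw [gaussianPDFReal_def]; fun_prop
    have hp : ContDiff ℝ 1 (fun x => p.eval x) := by
      simp_rw [← Polynomial.coe_aeval_eq_eval]
      exact Polynomial.contDiff_aeval p 1
    exact this.mul hp
  have h1 := integrable_gaussianPDFReal_mul (integrable_mul_polynomial_eval hf p)
  have h2 := integrable_gaussianPDFReal_mul (integrable_mul_polynomial_eval hf' p)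
  have h3 := integrable_gaussianPDFReal_mul
    (integrable_mul_polynomial_eval hf (Polynomial.X * p - p.derivative))
  have key := integral_eq_zero_of_intervalIntegral_eq_sub
    (F := fun x => f x * g x) (G := fun x => deriv f x * g x + f x * deriv g x)
    (h1.congr (ae_of_all _ fun x => by simp [hg]; ring))
    ((h2.sub h3).congr (ae_of_all _ fun x => by
      simp only [(hgd x).deriv, Pi.sub_apply]; simp only [hg]; ring))
    (fun a b => (hac a b).integral_deriv_mul_eq_sub
      (hgc.contDiffOn.absolutelyContinuousOnInterval))
  rw [integral_gaussianReal_eq_integral_smul one_ne_zero,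
    integral_gaussianReal_eq_integral_smul one_ne_zero, ← sub_eq_zero]
  simp only [smul_eq_mul]
  rw [← integral_sub h2 h3]
  refine Eq.trans ?_ key
  congr 1 with x
  rw [(hgd x).deriv, hg]
  ring

-- The Appell property, which turns integration by parts into a recursion for Hermite correlations.
open Polynomial in
lemma derivative_hermite_succ (n : ℕ) :
    derivative (hermite (n + 1)) = ((n + 1 : ℕ) : ℤ[X]) * hermite n := by
  induction n with
  | zero => simp
  | succ n ih =>
    rw [hermite_succ (n + 1), derivative_sub, derivative_mul, derivative_X, ih, hermite_succ n]
    simp only [derivative_mul, derivative_natCast, zero_mul, zero_add]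
    push_cast
    ring

lemma integral_X_mul_sub_derivative_gaussianReal (p : Polynomial ℝ) :
    ∫ x, (Polynomial.X * p - p.derivative).eval x ∂(gaussianReal 0 1) = 0 := by
  have h := integral_deriv_mul_polynomial_gaussianReal (f := fun _ => (1 : ℝ))
    (fun a b => (contDiff_const.contDiffOn).absolutelyContinuousOnInterval)
    (memLp_const 1) (by simp) p
  simpa using h.symm

/-! ### Correlated Gaussian pairs and Mehler's formula. -/

/-- A linear combination `ρ X + √(1 - ρ²) Z` of independent standard Gaussian variables is
standard Gaussian. -/
lemma measurePreserving_gaussianReal_rotation {ρ : ℝ} (hρ : ρ ^ 2 ≤ 1) :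
    MeasurePreserving (fun p : ℝ × ℝ => ρ * p.1 + √(1 - ρ ^ 2) * p.2)
      ((gaussianReal 0 1).prod (gaussianReal 0 1)) (gaussianReal 0 1) := by
  refine ⟨by fun_prop, ?_⟩
  have h : (fun p : ℝ × ℝ => ρ * p.1 + √(1 - ρ ^ 2) * p.2)
      = (fun p : ℝ × ℝ => p.1 + p.2) ∘ Prod.map (ρ * ·) (√(1 - ρ ^ 2) * ·) := rfl
  rw [h, ← Measure.map_map (by fun_prop) (by fun_prop),
    ← Measure.map_prod_map _ _ (by fun_prop) (by fun_prop), ← Measure.conv,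
    gaussianReal_map_const_mul, gaussianReal_map_const_mul, gaussianReal_conv_gaussianReal]
  congr 1
  · simp
  · ext
    simp [Real.sq_sqrt (sub_nonneg.2 hρ)]

lemma measurePreserving_gaussianReal_fst :
    MeasurePreserving (Prod.fst : ℝ × ℝ → ℝ)
      ((gaussianReal 0 1).prod (gaussianReal 0 1)) (gaussianReal 0 1) :=
  measurePreserving_fst

lemma integrable_gaussian_pair {ρ : ℝ} (hρ : ρ ^ 2 ≤ 1) {f g : ℝ → ℝ}
    (hf : MemLp f 2 (gaussianReal 0 1)) (hg : MemLp g 2 (gaussianReal 0 1)) :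
    Integrable (fun p : ℝ × ℝ => f p.1 * g (ρ * p.1 + √(1 - ρ ^ 2) * p.2))
      ((gaussianReal 0 1).prod (gaussianReal 0 1)) :=
  (hf.comp_measurePreserving measurePreserving_gaussianReal_fst).integrable_mul
    (hg.comp_measurePreserving (measurePreserving_gaussianReal_rotation hρ))

open Polynomial in
/-- Integration by parts in the first of two correlated Gaussian variables. -/
lemma integral_gaussian_pair_parts {ρ : ℝ} (hρ : ρ ^ 2 ≤ 1) (p q : ℝ[X]) :
    ∫ z : ℝ × ℝ, (X * p - derivative p).eval z.1 * q.eval (ρ * z.1 + √(1 - ρ ^ 2) * z.2)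
        ∂((gaussianReal 0 1).prod (gaussianReal 0 1))
      = ρ * ∫ z : ℝ × ℝ, p.eval z.1 * (derivative q).eval (ρ * z.1 + √(1 - ρ ^ 2) * z.2)
        ∂((gaussianReal 0 1).prod (gaussianReal 0 1)) := by
  have hint := fun p q : ℝ[X] =>
    integrable_gaussian_pair hρ (memLp_two_polynomial_eval p) (memLp_two_polynomial_eval q)
  rw [← sub_eq_zero, ← integral_const_mul, ← integral_sub (hint _ _) ((hint _ _).const_mul ρ)]
  -- For fixed second coordinate `y`, the difference is `X P - P'` with `P = p · q(ρ X + √(1 - ρ²)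
  -- y)`, which has mean zero.
  refine (integral_prod_symm _ ((hint _ _).sub ((hint _ _).const_mul ρ))).trans ?_
  refine integral_eq_zero_of_ae (ae_of_all _ fun y => ?_)
  have h := integral_X_mul_sub_derivative_gaussianReal
    (p * q.comp (C ρ * X + C (√(1 - ρ ^ 2) * y)))
  refine Eq.trans (integral_congr_ae (ae_of_all _ fun x => ?_)) h
  simp [derivative_comp]
  ring

/-- The `k`-th probabilists' Hermite polynomial, with real coefficients. -/
noncomputable def realHermite (k : ℕ) : Polynomial ℝ :=
  (Polynomial.hermite k).map (Int.castRingHom ℝ)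

open Polynomial in
lemma realHermite_succ (k : ℕ) :
    realHermite (k + 1) = X * realHermite k - derivative (realHermite k) := by
  simp [realHermite, hermite_succ, derivative_map]

open Polynomial in
lemma derivative_realHermite_succ (k : ℕ) :
    derivative (realHermite (k + 1)) = C ((k : ℝ) + 1) * realHermite k := by
  rw [realHermite, derivative_map, derivative_hermite_succ, realHermite]
  simp

lemma realHermite_zero : realHermite 0 = 1 := by simp [realHermite]

lemma realHermite_one : realHermite 1 = Polynomial.X := by simp [realHermite]

/-- Mehler's formula for the correlation of Hermite polynomials. -/
lemma integral_realHermite_pair {ρ : ℝ} (hρ : ρ ^ 2 ≤ 1) (j k : ℕ) :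
    ∫ z : ℝ × ℝ, (realHermite j).eval z.1 * (realHermite k).eval (ρ * z.1 + √(1 - ρ ^ 2) * z.2)
        ∂((gaussianReal 0 1).prod (gaussianReal 0 1))
      = if j = k then (k.factorial : ℝ) * ρ ^ k else 0 := by
  induction j generalizing k with
  | zero =>
    cases k with
    | zero => simp [realHermite_zero]
    | succ k =>
      have h := (measurePreserving_gaussianReal_rotation hρ).map_eq
      have h2 := integral_X_mul_sub_derivative_gaussianReal (realHermite k)
      rw [← realHermite_succ, ← h, integral_map (by fun_prop) (by fun_prop)] at h2
      simpa [realHermite_zero] using h2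
  | succ j ih =>
    rw [realHermite_succ j, integral_gaussian_pair_parts hρ]
    cases k with
    | zero => simp [realHermite_zero]
    | succ k =>
      simp_rw [derivative_realHermite_succ, Polynomial.eval_mul, Polynomial.eval_C,
        mul_left_comm _ ((k : ℝ) + 1)]
      rw [integral_const_mul, ih k]
      by_cases hjk : j = k
      · simp [hjk, Nat.factorial_succ]
        ring
      · simp [hjk]

lemma integral_realHermite_mul (j k : ℕ) :
    ∫ x, (realHermite j).eval x * (realHermite k).eval x ∂(gaussianReal 0 1)
      = if j = k then (k.factorial : ℝ) else 0 := by
  have h := integral_realHermite_pair (ρ := 1) (by norm_num) j k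
  rw [← measurePreserving_gaussianReal_fst.map_eq, integral_map (by fun_prop) (by fun_prop)]
  simpa using h

/-! ### Completeness of the Hermite polynomials. -/

lemma memLp_two_exp_abs_gaussianReal (t : ℝ) :
    MemLp (fun x => Real.exp |t * x|) 2 (gaussianReal 0 1) := by
  rw [memLp_two_iff_integrable_sq (by fun_prop)]
  refine Integrable.mono' ((integrable_exp_mul_gaussianReal (2 * t)).add
    (integrable_exp_mul_gaussianReal (-(2 * t)))) (by fun_prop) (ae_of_all _ fun x => ?_)
  rw [Real.norm_of_nonneg (by positivity), ← Real.exp_nat_mul]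
  simp only [Pi.add_apply]
  rcases abs_cases (t * x) with ⟨h, -⟩ | ⟨h, -⟩ <;> rw [h]
  · refine le_trans (Real.exp_le_exp.2 (le_of_eq ?_)) (le_add_of_nonneg_right (Real.exp_pos _).le)
    push_cast; ring
  · refine le_trans (Real.exp_le_exp.2 (le_of_eq ?_)) (le_add_of_nonneg_left (Real.exp_pos _).le)
    push_cast; ring

/-- Expand the exponential: each term is a multiple of a moment, and `|f| exp |t x|`, a product of
two square integrable functions, dominates the series. -/
lemma integral_mul_cexp_eq_zero_of_moments {f : ℝ → ℝ} (hf : MemLp f 2 (gaussianReal 0 1))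
    (h : ∀ n : ℕ, ∫ x, f x * x ^ n ∂(gaussianReal 0 1) = 0) (t : ℝ) :
    ∫ x, (f x : ℂ) * Complex.exp (t * x * Complex.I) ∂(gaussianReal 0 1) = 0 := by
  have hsum : HasSum (fun n : ℕ => ∫ x, (f x : ℂ) * ((t * x * Complex.I) ^ n / n.factorial)
      ∂(gaussianReal 0 1))
      (∫ x, (f x : ℂ) * Complex.exp (t * x * Complex.I) ∂(gaussianReal 0 1)) := by
    have hexp : ∀ x : ℝ, HasSum (fun n : ℕ => |f x| * (|t * x| ^ n / n.factorial))
        (|f x| * Real.exp |t * x|) := fun x => by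
      rw [Real.exp_eq_exp_ℝ]
      exact (NormedSpace.expSeries_div_hasSum_exp |t * x|).mul_left _
    have hcexp : ∀ z : ℂ, HasSum (fun n : ℕ => z ^ n / n.factorial) (Complex.exp z) := fun z => by
      rw [Complex.exp_eq_exp_ℂ]
      exact NormedSpace.expSeries_div_hasSum_exp z
    refine hasSum_integral_of_dominated_convergence
      (fun n x => |f x| * (|t * x| ^ n / n.factorial)) (fun n => ?_)
      (fun n => ae_of_all _ fun x => ?_) (ae_of_all _ fun x => (hexp x).summable) ?_
      (ae_of_all _ fun x => ?_)
    · have h1 : AEStronglyMeasurable (fun x => (f x : ℂ)) (gaussianReal 0 1) :=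
        Complex.continuous_ofReal.comp_aestronglyMeasurable hf.1
      have h2 : Continuous fun x : ℝ => (t * x * Complex.I) ^ n / (n.factorial : ℂ) := by fun_prop
      exact h1.mul h2.aestronglyMeasurable
    · simp [abs_mul]
    · have hb : (fun x => ∑' n : ℕ, |f x| * (|t * x| ^ n / n.factorial))
          = fun x => |f x| * Real.exp |t * x| := funext fun x => (hexp x).tsum_eq
      have h1 : MemLp (fun x => |f x|) 2 (gaussianReal 0 1) := hf.norm
      have h2 : Integrable (fun x => |f x| * Real.exp |t * x|) (gaussianReal 0 1) :=
        h1.integrable_mul (memLp_two_exp_abs_gaussianReal t)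
      rw [hb]
      exact h2
    · exact (hcexp _).mul_left _
  refine hsum.unique ?_
  convert! (hasSum_zero : HasSum (fun _ : ℕ => (0 : ℂ)) 0) using 1
  ext n
  have : ∀ x : ℝ, (f x : ℂ) * ((t * x * Complex.I) ^ n / n.factorial)
      = ((t * Complex.I) ^ n / n.factorial) * ((f x * x ^ n : ℝ) : ℂ) := fun x => by
    push_cast; ring
  simp_rw [this]
  rw [integral_const_mul, integral_complex_ofReal, h n]
  simp

/-- Polynomials are complete in `L²` of the standard Gaussian measure. -/
lemma ae_eq_zero_of_moments_eq_zero {f : ℝ → ℝ} (hf : MemLp f 2 (gaussianReal 0 1))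
    (h : ∀ n : ℕ, ∫ x, f x * x ^ n ∂(gaussianReal 0 1) = 0) :
    f =ᵐ[gaussianReal 0 1] 0 := by
  have hint : Integrable f (gaussianReal 0 1) := hf.integrable (by norm_num)
  have := isFiniteMeasure_withDensity_ofReal hint.2
  have := isFiniteMeasure_withDensity_ofReal hint.neg.2
  have hm : AEMeasurable (fun x => ENNReal.ofReal (f x)) (gaussianReal 0 1) :=
    hint.1.aemeasurable.ennreal_ofReal
  have hm' : AEMeasurable (fun x => ENNReal.ofReal ((-f) x)) (gaussianReal 0 1) :=
    hint.neg.1.aemeasurable.ennreal_ofReal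
  -- The positive and negative parts of `f` define finite measures with the same characteristic
  -- function, so they agree and both parts vanish.
  have key : (gaussianReal 0 1).withDensity (fun x => ENNReal.ofReal (f x))
      = (gaussianReal 0 1).withDensity (fun x => ENNReal.ofReal ((-f) x)) := by
    refine Measure.ext_of_charFun (funext fun t => ?_)
    rw [charFun_apply_real, charFun_apply_real,
      integral_withDensity_eq_integral_toReal_smul₀ hm (ae_of_all _ fun _ => ENNReal.ofReal_lt_top),
      integral_withDensity_eq_integral_toReal_smul₀ hm' (ae_of_all _ fun _ => ENNReal.ofReal_lt_top),
      ← sub_eq_zero]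
    have hb : ∀ g : ℝ → ℝ, Integrable g (gaussianReal 0 1) → Integrable
        (fun x => (ENNReal.ofReal (g x)).toReal • Complex.exp (t * x * Complex.I))
        (gaussianReal 0 1) := fun g hg => by
      simp_rw [ENNReal.toReal_ofReal', Complex.real_smul]
      refine Integrable.mul_bdd (c := 1) hg.pos_part.ofReal (by fun_prop) (ae_of_all _ fun x => ?_)
      rw [← Complex.ofReal_mul, Complex.norm_exp_ofReal_mul_I]
    rw [← integral_sub (hb f hint) (hb (-f) hint.neg),
      ← integral_mul_cexp_eq_zero_of_moments hf h t]
    congr 1 with x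
    rw [← sub_smul, ENNReal.toReal_ofReal', ENNReal.toReal_ofReal', Pi.neg_apply,
      max_zero_sub_eq_self, Complex.real_smul]
  have h2 := (withDensity_eq_iff hm hm' hint.lintegral_lt_top.ne).1 key
  filter_upwards [h2] with x hx
  simp only [Pi.neg_apply] at hx
  rcases le_total (f x) 0 with h0 | h0
  · rw [ENNReal.ofReal_of_nonpos h0, eq_comm, ENNReal.ofReal_eq_zero] at hx
    simp only [Pi.zero_apply]; linarith
  · rw [ENNReal.ofReal_of_nonpos (neg_nonpos.2 h0), ENNReal.ofReal_eq_zero] at hx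
    simp only [Pi.zero_apply]; linarith

open Polynomial in
lemma span_range_realHermite : Submodule.span ℝ (Set.range realHermite) = ⊤ := by
  have hdeg : ∀ k, (realHermite k).degree = k := fun k => by
    rw [realHermite, (hermite_monic k).degree_map, degree_hermite]
  have hmonic : ∀ k, (realHermite k).Monic := fun k => (hermite_monic k).map _
  exact Polynomial.Sequence.span ⟨realHermite, hdeg⟩ fun k => by
    simp [(hmonic k).leadingCoeff]

/-- The normalized Hermite polynomials in `L²` of the standard Gaussian measure. -/
noncomputable def hermiteLp (k : ℕ) : Lp ℝ 2 (gaussianReal 0 1) :=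
  (√(k.factorial : ℝ))⁻¹ • (memLp_two_polynomial_eval (realHermite k)).toLp _

lemma inner_toLp_toLp {α : Type*} [MeasurableSpace α] {ν : Measure α} {f g : α → ℝ}
    (hf : MemLp f 2 ν) (hg : MemLp g 2 ν) :
    inner ℝ (hf.toLp f) (hg.toLp g) = ∫ x, f x * g x ∂ν := by
  rw [L2.inner_def]
  refine integral_congr_ae ?_
  filter_upwards [hf.coeFn_toLp, hg.coeFn_toLp] with x hx hy
  simp [hx, hy, mul_comm]

lemma orthonormal_hermiteLp : Orthonormal ℝ hermiteLp := by
  rw [orthonormal_iff_ite]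
  intro j k
  rw [hermiteLp, hermiteLp, real_inner_smul_left, real_inner_smul_right, inner_toLp_toLp,
    integral_realHermite_mul]
  split_ifs with hjk
  · subst hjk
    have : (√(j.factorial : ℝ)) ≠ 0 := by positivity
    field_simp
    rw [Real.sq_sqrt (by positivity)]
  · simp

lemma span_hermiteLp_orthogonal : (Submodule.span ℝ (Set.range hermiteLp))ᗮ = ⊥ := by
  rw [Submodule.eq_bot_iff]
  intro f hf
  have h : ∀ p : Polynomial ℝ, ∫ x, f x * p.eval x ∂(gaussianReal 0 1) = 0 := by
    intro p
    have hp : p ∈ Submodule.span ℝ (Set.range realHermite) := by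
      rw [span_range_realHermite]; trivial
    induction hp using Submodule.span_induction with
    | mem q hq =>
      obtain ⟨k, rfl⟩ := hq
      have h1 := (Submodule.mem_orthogonal' _ _).1 hf _ (Submodule.subset_span ⟨k, rfl⟩)
      rw [hermiteLp, real_inner_smul_right] at h1
      have h2 : (√(k.factorial : ℝ))⁻¹ ≠ 0 := by positivity
      have h3 := (mul_eq_zero.1 h1).resolve_left h2
      rwa [← Lp.toLp_coeFn f (Lp.memLp f), inner_toLp_toLp] at h3
    | zero => simp
    | add q r _ _ hq hr =>
      simp_rw [Polynomial.eval_add, mul_add]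
      rw [integral_add (integrable_mul_polynomial_eval (Lp.memLp f) q)
        (integrable_mul_polynomial_eval (Lp.memLp f) r), hq, hr, add_zero]
    | smul c q _ hq =>
      simp_rw [Polynomial.eval_smul, smul_eq_mul, mul_left_comm _ c]
      rw [integral_const_mul, hq, mul_zero]
  rw [Lp.eq_zero_iff_ae_eq_zero]
  exact ae_eq_zero_of_moments_eq_zero (Lp.memLp f) fun n => by simpa using h (Polynomial.X ^ n)

/-- The Hermite polynomials as a Hilbert basis of `L²` of the standard Gaussian measure. -/
noncomputable def hermiteBasis : HilbertBasis ℕ ℝ (Lp ℝ 2 (gaussianReal 0 1)) :=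
  HilbertBasis.mkOfOrthogonalEqBot orthonormal_hermiteLp span_hermiteLp_orthogonal

lemma hermiteBasis_apply (k : ℕ) : hermiteBasis k = hermiteLp k := by
  rw [hermiteBasis, HilbertBasis.coe_mkOfOrthogonalEqBot]

/-! ### Power series of the dual activation and bounds on it. -/

/-- The Hermite coefficients of a function, with respect to the normalized polynomials. -/
noncomputable def hermiteCoeff (f : ℝ → ℝ) (k : ℕ) : ℝ :=
  (√(k.factorial : ℝ))⁻¹ * ∫ x, f x * (realHermite k).eval x ∂(gaussianReal 0 1)

lemma inner_toLp_hermiteLp {f : ℝ → ℝ} (hf : MemLp f 2 (gaussianReal 0 1)) (k : ℕ) :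
    inner ℝ (hf.toLp f) (hermiteLp k) = hermiteCoeff f k := by
  rw [hermiteLp, real_inner_smul_right, inner_toLp_toLp, hermiteCoeff]

/-- The dual activation is the power series of the squared Hermite coefficients. -/
lemma hasSum_dualActivation {f : ℝ → ℝ} (hf : MemLp f 2 (gaussianReal 0 1)) {ρ : ℝ}
    (hρ : ρ ^ 2 ≤ 1) :
    HasSum (fun k => hermiteCoeff f k ^ 2 * ρ ^ k) (dualActivation f ρ) := by
  have hm1 := measurePreserving_gaussianReal_fst
  have hm2 := measurePreserving_gaussianReal_rotation hρ
  -- `J` and `R` compose with the two correlated coordinates, so the dual activation is `⟨J f, R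
  -- f⟩`; by Mehler, `⟨J h_j, R h_k⟩` is diagonal with entries `ρ^k`.
  set J : Lp ℝ 2 (gaussianReal 0 1) →L[ℝ] Lp ℝ 2 ((gaussianReal 0 1).prod (gaussianReal 0 1)) :=
    (Lp.compMeasurePreservingₗᵢ ℝ _ hm1).toContinuousLinearMap with hJ
  set R : Lp ℝ 2 (gaussianReal 0 1) →L[ℝ] Lp ℝ 2 ((gaussianReal 0 1).prod (gaussianReal 0 1)) :=
    (Lp.compMeasurePreservingₗᵢ ℝ _ hm2).toContinuousLinearMap with hR
  have hJR : ∀ {g h : ℝ → ℝ} (hg : MemLp g 2 (gaussianReal 0 1))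
      (hh : MemLp h 2 (gaussianReal 0 1)), inner ℝ (J (hg.toLp g)) (R (hh.toLp h))
        = ∫ p : ℝ × ℝ, g p.1 * h (ρ * p.1 + √(1 - ρ ^ 2) * p.2)
          ∂((gaussianReal 0 1).prod (gaussianReal 0 1)) := by
    intro g h hg hh
    have h1 : J (hg.toLp g) = (hg.comp_measurePreserving hm1).toLp _ :=
      Lp.toLp_compMeasurePreserving hg hm1
    have h2 : R (hh.toLp h) = (hh.comp_measurePreserving hm2).toLp _ :=
      Lp.toLp_compMeasurePreserving hh hm2
    rw [h1, h2, inner_toLp_toLp]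
    rfl
  have hexp : ∀ F : Lp ℝ 2 (gaussianReal 0 1),
      HasSum (fun k => inner ℝ F (hermiteLp k) • hermiteLp k) F := fun F => by
    have := hermiteBasis.hasSum_repr F
    simpa only [HilbertBasis.repr_apply_apply, hermiteBasis_apply, real_inner_comm] using this
  have hJRk : ∀ j k, inner ℝ (J (hermiteLp j)) (R (hermiteLp k)) = if j = k then ρ ^ k else 0 := by
    intro j k
    rw [hermiteLp, hermiteLp, map_smul, map_smul, real_inner_smul_left, real_inner_smul_right, hJR,
      integral_realHermite_pair hρ]
    split_ifs with hjk
    · subst hjk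
      have : (√(j.factorial : ℝ)) ≠ 0 := by positivity
      field_simp
      rw [Real.sq_sqrt (by positivity)]
    · simp
  have hR1 : ∀ k, inner ℝ (J (hf.toLp f)) (R (hermiteLp k)) = hermiteCoeff f k * ρ ^ k := by
    intro k
    have h1 := ((innerSL ℝ (R (hermiteLp k))).comp J).hasSum (hexp (hf.toLp f))
    rw [ContinuousLinearMap.comp_apply, innerSL_apply_apply, real_inner_comm] at h1
    refine h1.unique ?_
    convert! hasSum_ite_eq k (hermiteCoeff f k * ρ ^ k) using 1
    ext j
    simp only [map_smul, inner_toLp_hermiteLp,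
      ContinuousLinearMap.comp_apply, innerSL_apply_apply, smul_eq_mul]
    rw [real_inner_comm, hJRk]
    split_ifs with hjk <;> simp [hjk]
  have h1 := ((innerSL ℝ (J (hf.toLp f))).comp R).hasSum (hexp (hf.toLp f))
  rw [ContinuousLinearMap.comp_apply, innerSL_apply_apply, hJR] at h1
  convert! h1 using 1
  ext k
  simp only [map_smul, inner_toLp_hermiteLp, ContinuousLinearMap.comp_apply,
    innerSL_apply_apply, hR1, smul_eq_mul]
  ring

lemma dualActivation_one (f : ℝ → ℝ) (hf : AEStronglyMeasurable f (gaussianReal 0 1)) :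
    dualActivation f 1 = ∫ x, f x ^ 2 ∂(gaussianReal 0 1) := by
  have h := measurePreserving_gaussianReal_fst
  rw [← h.map_eq, integral_map h.aemeasurable (by rw [h.map_eq]; exact hf.pow 2), dualActivation]
  simp [sq]

/-- Every term with `k ≥ 1` gains a factor `|ρ|`; only the constant coefficient does not. -/
lemma abs_le_of_hasSum_pow {c : ℕ → ℝ} (hc : ∀ k, 0 ≤ c k) {S s ρ : ℝ} (hS : HasSum c S)
    (hs : HasSum (fun k => c k * ρ ^ k) s) (hρ : |ρ| ≤ 1) :
    |s| ≤ c 0 + (S - c 0) * |ρ| := by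
  have h := (hS.mul_right |ρ|).add (hasSum_ite_eq 0 (c 0 * (1 - |ρ|)))
  refine (hs.norm_le_of_bounded h fun k => ?_).trans (le_of_eq (by ring))
  rw [Real.norm_eq_abs, abs_mul, abs_pow, abs_of_nonneg (hc k)]
  rcases eq_or_ne k 0 with rfl | hk
  · simp; linarith
  · rw [if_neg hk, add_zero]
    gcongr
    · exact hc k
    · exact pow_le_of_le_one (abs_nonneg _) hρ hk

/-- Factor out one `ρ` and apply the previous bound to the shifted series. -/
lemma abs_le_of_hasSum_pow_of_zero {c : ℕ → ℝ} (hc : ∀ k, 0 ≤ c k) {S s ρ : ℝ}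
    (h0 : c 0 = 0) (hS : HasSum c S) (hs : HasSum (fun k => c k * ρ ^ k) s) (hρ : |ρ| ≤ 1) :
    |s| ≤ |ρ| * (c 1 + (S - c 1) * |ρ|) := by
  have hS1 : HasSum (fun k => c (k + 1)) S := by
    simpa [h0] using (hasSum_nat_add_iff' 1).2 hS
  have hsm : Summable (fun k => c (k + 1) * ρ ^ k) := by
    refine Summable.of_norm_bounded hS1.summable fun k => ?_
    rw [Real.norm_eq_abs, abs_mul, abs_pow, abs_of_nonneg (hc _)]
    exact mul_le_of_le_one_right (hc _) (pow_le_one₀ (abs_nonneg _) hρ)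
  have hs1 : HasSum (fun k => c (k + 1) * ρ ^ (k + 1)) s := by
    simpa [h0] using (hasSum_nat_add_iff' 1).2 hs
  have heq : s = ρ * ∑' k, c (k + 1) * ρ ^ k := by
    refine hs1.unique ?_
    convert! hsm.hasSum.mul_left ρ using 1
    ext k
    ring
  rw [heq, abs_mul]
  gcongr
  exact abs_le_of_hasSum_pow (c := fun k => c (k + 1)) (fun k => hc _) hS1 hsm.hasSum hρ

/-! ### Coefficient identities for a normalized activation. -/

namespace IsNormalizedActivation

variable {σ : ℝ → ℝ}

lemma hermiteCoeff_zero (h : IsNormalizedActivation σ) : hermiteCoeff σ 0 = 0 := by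
  simp [hermiteCoeff, realHermite_zero, h.mean_zero]

lemma hermiteCoeff_one_sq : hermiteCoeff σ 1 ^ 2 = 1 - nonlinCoeff σ := by
  simp [hermiteCoeff, realHermite_one, nonlinCoeff, mul_comm]

/-- Integration by parts moves the derivative onto `H_k` and yields `H_{k+1}`; the factor `k + 1` is
the ratio of the normalizing factorials. -/
lemma hermiteCoeff_deriv_sq (h : IsNormalizedActivation σ) (k : ℕ) :
    hermiteCoeff (deriv σ) k ^ 2 = (k + 1) * hermiteCoeff σ (k + 1) ^ 2 := by
  rw [hermiteCoeff, hermiteCoeff,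
    integral_deriv_mul_polynomial_gaussianReal h.absCont h.memLp h.memLp_deriv, ← realHermite_succ,
    mul_pow, mul_pow, inv_pow, inv_pow, Real.sq_sqrt (by positivity), Real.sq_sqrt (by positivity),
    Nat.factorial_succ]
  push_cast
  field_simp

lemma dualActivation_one (h : IsNormalizedActivation σ) : dualActivation σ 1 = 1 := by
  rw [_root_.dualActivation_one σ h.memLp.1, h.second_moment]

lemma hasSum_hermiteCoeff_sq (h : IsNormalizedActivation σ) :
    HasSum (fun k => hermiteCoeff σ k ^ 2) 1 := by
  simpa [h.dualActivation_one] using hasSum_dualActivation h.memLp (ρ := 1) (by norm_num)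

lemma nonlinCoeff_le_one : nonlinCoeff σ ≤ 1 := by
  rw [nonlinCoeff]
  linarith [sq_nonneg (∫ z, z * σ z ∂(gaussianReal 0 1))]

lemma abs_dualActivation_le (h : IsNormalizedActivation σ) {ρ : ℝ} (hρ : |ρ| ≤ 1) :
    |dualActivation σ ρ| ≤ |ρ| * (1 - nonlinCoeff σ + nonlinCoeff σ * |ρ|) := by
  have := abs_le_of_hasSum_pow_of_zero (fun k => sq_nonneg (hermiteCoeff σ k))
    (by simp [h.hermiteCoeff_zero]) h.hasSum_hermiteCoeff_sq
    (hasSum_dualActivation h.memLp ((sq_le_one_iff_abs_le_one ρ).2 hρ)) hρ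
  rwa [hermiteCoeff_one_sq, sub_sub_cancel] at this

lemma hasSum_hermiteCoeff_deriv_sq (h : IsNormalizedActivation σ) :
    HasSum (fun k => hermiteCoeff (deriv σ) k ^ 2) (dualActivation (deriv σ) 1) := by
  simpa using hasSum_dualActivation h.memLp_deriv (ρ := 1) (by norm_num)

lemma hermiteCoeff_deriv_zero_sq (h : IsNormalizedActivation σ) :
    hermiteCoeff (deriv σ) 0 ^ 2 = 1 - nonlinCoeff σ := by
  simp [h.hermiteCoeff_deriv_sq, hermiteCoeff_one_sq]

lemma abs_dualActivation_deriv_le (h : IsNormalizedActivation σ) {ρ : ℝ} (hρ : |ρ| ≤ 1) :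
    |dualActivation (deriv σ) ρ| ≤ 1 - nonlinCoeff σ
      + (dualActivation (deriv σ) 1 - (1 - nonlinCoeff σ)) * |ρ| := by
  have := abs_le_of_hasSum_pow (fun k => sq_nonneg (hermiteCoeff (deriv σ) k))
    h.hasSum_hermiteCoeff_deriv_sq
    (hasSum_dualActivation h.memLp_deriv ((sq_le_one_iff_abs_le_one ρ).2 hρ)) hρ
  rwa [h.hermiteCoeff_deriv_zero_sq] at this

/-- The derivative of a nonlinear normalized activation has second moment at least `1 + μ`. -/
lemma one_add_nonlinCoeff_le (h : IsNormalizedActivation σ) :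
    1 + nonlinCoeff σ ≤ dualActivation (deriv σ) 1 := by
  have h1 : HasSum (fun k => hermiteCoeff σ (k + 1) ^ 2) 1 := by
    simpa [h.hermiteCoeff_zero] using (hasSum_nat_add_iff' 1).2 h.hasSum_hermiteCoeff_sq
  -- The weight `k + 1` is at least 2 except at `k = 0`, where one copy of `a_1² = 1 - μ` is
  -- removed; the total is `2 - (1 - μ)`.
  have h2 := (h1.mul_left 2).sub (hasSum_ite_eq 0 (1 - nonlinCoeff σ))
  have h3 := hasSum_le (fun k => ?_) h2 h.hasSum_hermiteCoeff_deriv_sq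
  · linarith
  rw [h.hermiteCoeff_deriv_sq]
  rcases eq_or_ne k 0 with rfl | hk
  · rw [if_pos rfl, zero_add, hermiteCoeff_one_sq]
    push_cast
    linarith
  · rw [if_neg hk, sub_zero]
    have : (1 : ℝ) ≤ k := by exact_mod_cast Nat.one_le_iff_ne_zero.2 hk
    gcongr
    linarith

end IsNormalizedActivation

/-! ### Decay of the kernel with depth. -/

namespace IsNormalizedActivation

variable {σ : ℝ → ℝ}

lemma abs_iterate_lt_one (h : IsNormalizedActivation σ) (hμ : 0 < nonlinCoeff σ) {ρ : ℝ}
    (hρ : |ρ| < 1) (l : ℕ) : |(dualActivation σ)^[l] ρ| < 1 := by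
  induction l with
  | zero => simpa
  | succ l ih =>
    rw [Function.iterate_succ_apply']
    refine (h.abs_dualActivation_le ih.le).trans_lt (lt_of_le_of_lt ?_ ih)
    refine mul_le_of_le_one_right (abs_nonneg _) ?_
    nlinarith

lemma abs_iterate_succ_le (h : IsNormalizedActivation σ) (hμ : 0 < nonlinCoeff σ) {ρ : ℝ}
    (hρ : |ρ| < 1) (l : ℕ) :
    |(dualActivation σ)^[l + 1] ρ| ≤ |(dualActivation σ)^[l] ρ| *
      (1 - nonlinCoeff σ + nonlinCoeff σ * |(dualActivation σ)^[l] ρ|) := by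
  rw [Function.iterate_succ_apply']
  exact h.abs_dualActivation_le (h.abs_iterate_lt_one hμ hρ l).le

lemma antitone_abs_iterate (h : IsNormalizedActivation σ) (hμ : 0 < nonlinCoeff σ) {ρ : ℝ}
    (hρ : |ρ| < 1) : Antitone fun l => |(dualActivation σ)^[l] ρ| := by
  refine antitone_nat_of_succ_le fun l => (h.abs_iterate_succ_le hμ hρ l).trans ?_
  refine mul_le_of_le_one_right (abs_nonneg _) ?_
  nlinarith [h.abs_iterate_lt_one hμ hρ l]

lemma one_sub_abs_iterate_succ_ge (h : IsNormalizedActivation σ) (hμ : 0 < nonlinCoeff σ) {ρ : ℝ}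
    (hρ : |ρ| < 1) (l : ℕ) :
    (1 - |(dualActivation σ)^[l] ρ|) * (1 + nonlinCoeff σ * |(dualActivation σ)^[l] ρ|)
      ≤ 1 - |(dualActivation σ)^[l + 1] ρ| := by
  linarith [h.abs_iterate_succ_le hμ hρ l]

/-- Geometric decay of the ratio `|ρ| / (1 - |ρ|)` under iteration of the dual activation. -/
lemma abs_iterate_mul_pow_le (h : IsNormalizedActivation σ) (hμ : 0 < nonlinCoeff σ) {ρ : ℝ}
    (hρ : |ρ| < 1) (l : ℕ) :
    |(dualActivation σ)^[l] ρ| * (1 - |ρ|) * (1 + nonlinCoeff σ) ^ l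
      ≤ |ρ| * (1 - |(dualActivation σ)^[l] ρ|) := by
  induction l with
  | zero => simp
  | succ l ih =>
    have h1 := h.abs_iterate_succ_le hμ hρ l
    have h2 := h.one_sub_abs_iterate_succ_ge hμ hρ l
    have h3 := h.abs_iterate_lt_one hμ hρ l
    have h4 := nonlinCoeff_le_one (σ := σ)
    have h0 := abs_nonneg ((dualActivation σ)^[l] ρ)
    set μ := nonlinCoeff σ
    set r := |(dualActivation σ)^[l] ρ|
    set r' := |(dualActivation σ)^[l + 1] ρ|
    -- The left side equals `1 + μ r - μ² (1 - r)`.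
    have hq : (1 - μ + μ * r) * (1 + μ) ≤ 1 + μ * r := by
      nlinarith [mul_nonneg (sq_nonneg μ) (sub_nonneg.2 h3.le)]
    have hv : 0 ≤ 1 - |ρ| := by linarith
    calc r' * (1 - |ρ|) * (1 + μ) ^ (l + 1)
        ≤ r * (1 - μ + μ * r) * (1 - |ρ|) * (1 + μ) ^ (l + 1) := by gcongr
      _ = r * (1 - |ρ|) * (1 + μ) ^ l * ((1 - μ + μ * r) * (1 + μ)) := by ring
      _ ≤ r * (1 - |ρ|) * (1 + μ) ^ l * (1 + μ * r) := by gcongr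
      _ ≤ |ρ| * (1 - r) * (1 + μ * r) := by gcongr
      _ ≤ |ρ| * (1 - r') := by rw [mul_assoc]; gcongr

/-- The weights `1 - r` are chosen to telescope. Since the iterates decrease in absolute value, a
shift by `τ` only helps, which covers both conventions. -/
lemma abs_dualActivation_deriv_iterate_le (h : IsNormalizedActivation σ) (hμ : 0 < nonlinCoeff σ)
    {ρ : ℝ} (hρ : |ρ| < 1) (τ l : ℕ) :
    (1 - |(dualActivation σ)^[l] ρ|) *
        |dualActivation (deriv σ) ((dualActivation σ)^[l + τ] ρ)| * (1 + nonlinCoeff σ)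
      ≤ dualActivation (deriv σ) 1 * (1 - |(dualActivation σ)^[l + 1] ρ|) := by
  have h1 := h.abs_dualActivation_deriv_le (h.abs_iterate_lt_one hμ hρ (l + τ)).le
  have h2 := h.one_sub_abs_iterate_succ_ge hμ hρ l
  have h3 := h.abs_iterate_lt_one hμ hρ l
  have h4 := nonlinCoeff_le_one (σ := σ)
  have h5 := h.one_add_nonlinCoeff_le
  have h6 : |(dualActivation σ)^[l + τ] ρ| ≤ |(dualActivation σ)^[l] ρ| :=
    h.antitone_abs_iterate hμ hρ (Nat.le_add_right l τ)
  have h0 := abs_nonneg ((dualActivation σ)^[l] ρ)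
  set μ := nonlinCoeff σ
  set D := dualActivation (deriv σ) 1
  set r := |(dualActivation σ)^[l] ρ|
  set G := |dualActivation (deriv σ) ((dualActivation σ)^[l + τ] ρ)|
  have h7 : G ≤ 1 - μ + (D - (1 - μ)) * r := h1.trans (by gcongr; linarith)
  have h8 : G * (1 + μ) ≤ D * (1 + μ * r) := by
    calc G * (1 + μ) ≤ ((1 - μ) * (1 - r) + D * r) * (1 + μ) := by
          gcongr; linarith
      _ = (1 - μ) * (1 - r) * (1 + μ) + D * r * (1 + μ) := by ring
      -- Here `1 + μ ≤ D` makes `D` a common factor.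
      _ ≤ (1 - μ) * (1 - r) * D + D * r * (1 + μ) := by
          gcongr
      _ = D * (1 - μ + 2 * μ * r) := by ring
      _ ≤ D * (1 + μ * r) :=
          mul_le_mul_of_nonneg_left (by nlinarith) (by linarith)
  calc (1 - r) * G * (1 + μ) = (1 - r) * (G * (1 + μ)) := by ring
    _ ≤ (1 - r) * (D * (1 + μ * r)) := by
        gcongr
    _ = D * ((1 - r) * (1 + μ * r)) := by ring
    _ ≤ D * _ := by gcongr; linarith

lemma prod_abs_dualActivation_deriv_le (h : IsNormalizedActivation σ) (hμ : 0 < nonlinCoeff σ)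
    {ρ : ℝ} (hρ : |ρ| < 1) (τ a m : ℕ) :
    (1 - |(dualActivation σ)^[a] ρ|) *
        (∏ k ∈ Finset.Icc (a + 1) (a + m),
          |dualActivation (deriv σ) ((dualActivation σ)^[k - 1 + τ] ρ)|) * (1 + nonlinCoeff σ) ^ m
      ≤ dualActivation (deriv σ) 1 ^ m * (1 - |(dualActivation σ)^[a + m] ρ|) := by
  induction m with
  | zero => simp
  | succ m ih =>
    have h1 := h.abs_dualActivation_deriv_iterate_le hμ hρ τ (a + m)
    have h5 := h.one_add_nonlinCoeff_le
    rw [← add_assoc, Finset.prod_Icc_succ_top (by omega), Nat.add_sub_cancel]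
    set P := ∏ k ∈ Finset.Icc (a + 1) (a + m),
      |dualActivation (deriv σ) ((dualActivation σ)^[k - 1 + τ] ρ)|
    set G := |dualActivation (deriv σ) ((dualActivation σ)^[a + m + τ] ρ)|
    have hG : 0 ≤ G := abs_nonneg _
    set μ := nonlinCoeff σ
    set D := dualActivation (deriv σ) 1
    have hD : 0 ≤ D := by linarith
    calc (1 - |(dualActivation σ)^[a] ρ|) * (P * G) * (1 + μ) ^ (m + 1)
        = (1 - |(dualActivation σ)^[a] ρ|) * P * (1 + μ) ^ m * (G * (1 + μ)) := by ring
      _ ≤ D ^ m * (1 - |(dualActivation σ)^[a + m] ρ|) * (G * (1 + μ)) := by gcongr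
      _ = D ^ m * ((1 - |(dualActivation σ)^[a + m] ρ|) * G * (1 + μ)) := by ring
      _ ≤ D ^ m * (D * (1 - |(dualActivation σ)^[a + m + 1] ρ|)) := by gcongr
      _ = _ := by ring

lemma ntkFun_one (h : IsNormalizedActivation σ) (τ L : ℕ) :
    ntkFun σ τ L 1 = ∑ k ∈ Finset.Icc 1 (L + 1), dualActivation (deriv σ) 1 ^ (L + 1 - k) := by
  have hfix : ∀ l, (dualActivation σ)^[l] 1 = 1 := Function.iterate_fixed h.dualActivation_one
  simp [ntkFun, hfix]

lemma ntkFun_one_pos (h : IsNormalizedActivation σ) (hμ : 0 < nonlinCoeff σ) (τ L : ℕ) :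
    0 < ntkFun σ τ L 1 := by
  rw [h.ntkFun_one]
  exact Finset.sum_pos (fun k _ => pow_pos (by linarith [h.one_add_nonlinCoeff_le]) _) (by simp)

/-- The neural tangent kernel decays exponentially in the depth away from the diagonal. -/
lemma abs_ntkFun_le (h : IsNormalizedActivation σ) (hμ : 0 < nonlinCoeff σ) {ρ : ℝ}
    (hρ : |ρ| < 1) (τ L : ℕ) :
    (1 - |ρ|) * (1 + nonlinCoeff σ) ^ L * |ntkFun σ τ L ρ| ≤ |ρ| * ntkFun σ τ L 1 := by
  have hv : 0 ≤ 1 - |ρ| := by linarith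
  rw [h.ntkFun_one, Finset.mul_sum]
  calc (1 - |ρ|) * (1 + nonlinCoeff σ) ^ L * |ntkFun σ τ L ρ|
      ≤ (1 - |ρ|) * (1 + nonlinCoeff σ) ^ L * ∑ k ∈ Finset.Icc 1 (L + 1),
          |(dualActivation σ)^[k - 1] ρ| * ∏ k' ∈ Finset.Icc k L,
            |dualActivation (deriv σ) ((dualActivation σ)^[k' - 1 + τ] ρ)| := by
        gcongr
        rw [ntkFun]
        refine (Finset.abs_sum_le_sum_abs _ _).trans (le_of_eq ?_)
        simp_rw [abs_mul, Finset.abs_prod]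
    _ ≤ _ := by
        rw [Finset.mul_sum]
        refine Finset.sum_le_sum fun k hk => ?_
        obtain ⟨hk1, hk2⟩ := Finset.mem_Icc.1 hk
        -- The first `a` layers contribute `(1 + μ)^(-a)` and a factor `1 - r`, which cancels
        -- against the telescoped product over the other `m`.
        obtain ⟨a, rfl⟩ : ∃ a, k = a + 1 := ⟨k - 1, by omega⟩
        obtain ⟨m, rfl⟩ : ∃ m, L = a + m := ⟨L - a, by omega⟩
        rw [show a + m + 1 - (a + 1) = m by omega, Nat.add_sub_cancel]
        have h1 := h.abs_iterate_mul_pow_le hμ hρ a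
        have h2 := h.prod_abs_dualActivation_deriv_le hμ hρ τ a m
        have h5 := h.one_add_nonlinCoeff_le
        set P := ∏ k' ∈ Finset.Icc (a + 1) (a + m),
          |dualActivation (deriv σ) ((dualActivation σ)^[k' - 1 + τ] ρ)|
        have hP : 0 ≤ P := Finset.prod_nonneg fun _ _ => abs_nonneg _
        set r := |(dualActivation σ)^[a] ρ|
        set μ := nonlinCoeff σ
        set D := dualActivation (deriv σ) 1
        have hD : 0 ≤ D := by linarith
        calc (1 - |ρ|) * (1 + μ) ^ (a + m) * (r * P)
            = r * (1 - |ρ|) * (1 + μ) ^ a * (P * (1 + μ) ^ m) := by ring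
          _ ≤ |ρ| * (1 - r) * (P * (1 + μ) ^ m) := by gcongr
          _ = |ρ| * ((1 - r) * P * (1 + μ) ^ m) := by ring
          _ ≤ |ρ| * (D ^ m * (1 - |(dualActivation σ)^[a + m] ρ|)) := by gcongr
          _ ≤ |ρ| * D ^ m := by
              gcongr
              exact mul_le_of_le_one_right (by positivity)
                (by linarith [abs_nonneg ((dualActivation σ)^[a + m] ρ)])

/-- Past the convergence depth, the off-diagonal kernel entries are `O(n⁻⁴)` times the diagonal. -/
lemma abs_ntkFun_le_of_convDepth_le (h : IsNormalizedActivation σ) (hμ : 0 < nonlinCoeff σ)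
    {n : ℕ} (hn : 1 ≤ n) {δ ρ : ℝ} (hδ : 0 < δ) (hδ1 : δ ≤ 1) (hρ : |ρ| ≤ 1 - δ) (τ : ℕ) {L : ℕ}
    (hL : convDepth n δ (nonlinCoeff σ) ≤ L) :
    4 * (n : ℝ) ^ 4 * |ntkFun σ τ L ρ| ≤ ntkFun σ τ L 1 := by
  have h1 := h.abs_ntkFun_le hμ (by linarith : |ρ| < 1) τ L
  have hK := h.ntkFun_one_pos hμ τ L
  have hμ1 := nonlinCoeff_le_one (σ := σ)
  have hn0 : (0 : ℝ) < n := by exact_mod_cast hn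
  set μ := nonlinCoeff σ
  -- From `log (1 + μ) ≥ μ / (1 + μ)` and `μ ≤ 1`; the 8 in the depth thereby becomes the exponent
  -- 4.
  have hlog : μ / 2 ≤ Real.log (1 + μ) := by
    have := Real.one_sub_inv_le_log_of_pos (by linarith : 0 < 1 + μ)
    refine le_trans ?_ this
    rw [le_sub_iff_add_le, ← le_sub_iff_add_le', inv_le_iff_one_le_mul₀ (by linarith)]
    nlinarith
  have hpow : ((n : ℝ) / δ) ^ 4 ≤ (1 + μ) ^ L := by
    rw [← Real.log_le_log_iff (by positivity) (by positivity), Real.log_pow, Real.log_pow]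
    rw [convDepth, div_le_iff₀ hμ] at hL
    calc ((4 : ℕ) : ℝ) * Real.log (n / δ) ≤ L * (μ / 2) := by push_cast; linarith
      _ ≤ L * Real.log (1 + μ) := by gcongr
  set K := |ntkFun σ τ L ρ|
  have hK0 : 0 ≤ K := abs_nonneg _
  have h2 : δ * (n / δ) ^ 4 * K ≤ (1 - δ) * ntkFun σ τ L 1 := by
    calc δ * (n / δ) ^ 4 * K ≤ (1 - |ρ|) * (1 + μ) ^ L * K := by
          gcongr <;> linarith
      _ ≤ |ρ| * ntkFun σ τ L 1 := h1
      _ ≤ _ := by gcongr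
  have h3 : (n : ℝ) ^ 4 * K = δ ^ 3 * (δ * (n / δ) ^ 4 * K) := by
    field_simp
  -- Since `δ (1 - δ) ≤ 1/4`; this is the source of the factor 4 in the conclusion.
  have h4 : 4 * (δ ^ 3 * (1 - δ)) ≤ 1 := by
    have : δ ^ 3 ≤ δ := pow_le_of_le_one hδ.le hδ1 (by norm_num)
    nlinarith [sq_nonneg (2 * δ - 1), mul_le_mul_of_nonneg_right this (sub_nonneg.2 hδ1)]
  calc 4 * (n : ℝ) ^ 4 * K = 4 * δ ^ 3 * (δ * (n / δ) ^ 4 * K) := by rw [mul_assoc, h3]; ring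
    _ ≤ 4 * δ ^ 3 * ((1 - δ) * ntkFun σ τ L 1) := by gcongr
    _ = (4 * (δ ^ 3 * (1 - δ))) * ntkFun σ τ L 1 := by ring
    _ ≤ 1 * ntkFun σ τ L 1 := by gcongr
    _ = _ := one_mul _

end IsNormalizedActivation

/-! ### Perturbation of a multiple of the identity. -/

lemma Matrix.l2_opNorm_le_card_mul {n : ℕ} {E : Matrix (Fin n) (Fin n) ℝ} {b : ℝ} (hb : 0 ≤ b)
    (hE : ∀ i j, |E i j| ≤ b) : ‖E‖ ≤ n * b := by
  rw [Matrix.l2_opNorm_def]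
  refine ContinuousLinearMap.opNorm_le_bound _ (by positivity) fun x => ?_
  rw [EuclideanSpace.norm_eq]
  refine Real.sqrt_le_iff.2 ⟨by positivity, ?_⟩
  have hrow : ∀ i, (∑ j, E i j * x j) ^ 2 ≤ n * b ^ 2 * ‖x‖ ^ 2 := by
    intro i
    refine (Finset.sum_mul_sq_le_sq_mul_sq _ _ _).trans ?_
    rw [EuclideanSpace.real_norm_sq_eq]
    gcongr
    calc ∑ j, E i j ^ 2 ≤ ∑ _j : Fin n, b ^ 2 :=
          Finset.sum_le_sum fun j _ => sq_le_sq' (abs_le.1 (hE i j)).1 (abs_le.1 (hE i j)).2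
      _ = n * b ^ 2 := by simp
  calc _ = ∑ i, (∑ j, E i j * x j) ^ 2 := by
        simp [Matrix.mulVec, dotProduct]
    _ ≤ ∑ _i : Fin n, n * b ^ 2 * ‖x‖ ^ 2 := Finset.sum_le_sum fun i _ => hrow i
    _ = (n * b * ‖x‖) ^ 2 := by simp; ring

/-- Invertibility is the Neumann series; the norm bound absorbs `‖M⁻¹‖ κ / 4` into the left side of
`κ M⁻¹ = 1 - M⁻¹ (M - κ)`. -/
lemma Matrix.isUnit_of_norm_sub_smul_one_le {n : ℕ} {M : Matrix (Fin n) (Fin n) ℝ} {κ : ℝ}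
    (hκ : 0 < κ) (hM : ‖M - κ • 1‖ ≤ κ / 4) : IsUnit M ∧ ‖M⁻¹‖ ≤ 2 / κ := by
  have : CompleteSpace (Matrix (Fin n) (Fin n) ℝ) := FiniteDimensional.complete ℝ _
  have hU : IsUnit M := by
    have h1 : ‖-(κ⁻¹ • (M - κ • 1))‖ < 1 := by
      rw [norm_neg, norm_smul, Real.norm_of_nonneg (by positivity), inv_mul_lt_iff₀ hκ]
      linarith
    have h2 := (isUnit_one_sub_of_norm_lt_one h1).smul (Units.mk0 κ hκ.ne')
    convert! h2 using 1
    rw [Units.smul_mk0, sub_neg_eq_add, smul_add, smul_smul, mul_inv_cancel₀ hκ.ne', one_smul]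
    abel
  refine ⟨hU, ?_⟩
  have h3 : κ • M⁻¹ = 1 - M⁻¹ * (M - κ • 1) := by
    rw [mul_sub, Matrix.nonsing_inv_mul _ ((Matrix.isUnit_iff_isUnit_det M).1 hU)]
    simp
  have h1 : ‖(1 : Matrix (Fin n) (Fin n) ℝ)‖ ≤ 1 := by
    rw [← Matrix.diagonal_one, Matrix.l2_opNorm_diagonal]
    exact (pi_norm_le_iff_of_nonneg zero_le_one).2 fun _ => by simp
  have h4 : κ * ‖M⁻¹‖ ≤ 1 + ‖M⁻¹‖ * (κ / 4) := by
    calc κ * ‖M⁻¹‖ = ‖κ • M⁻¹‖ := by rw [norm_smul, Real.norm_of_nonneg hκ.le]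
      _ ≤ ‖(1 : Matrix (Fin n) (Fin n) ℝ)‖ + ‖M⁻¹ * (M - κ • 1)‖ := by
          rw [h3]; exact norm_sub_le _ _
      _ ≤ 1 + ‖M⁻¹‖ * ‖M - κ • 1‖ := add_le_add h1 (norm_mul_le _ _)
      _ ≤ _ := by gcongr
  rw [le_div_iff₀ hκ]
  nlinarith [mul_nonneg hκ.le (norm_nonneg M⁻¹)]

/-- Stability of the inverse of a strongly diagonally dominant matrix under sparsification. -/
lemma isUnit_and_norm_inv_sparsify_le {n : ℕ} (hn : 1 ≤ n) {K : Matrix (Fin n) (Fin n) ℝ} {κ : ℝ}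
    (hκ : 0 < κ) (hdiag : ∀ i, K i i = κ)
    (hoff : ∀ i j, i ≠ j → 4 * (n : ℝ) ^ 4 * |K i j| ≤ κ) (S : Fin n → Finset (Fin n)) :
    IsUnit K ∧ IsUnit (sparsify K S) ∧ ‖(sparsify K S)⁻¹ - K⁻¹‖ / ‖K⁻¹‖ ≤ 1 / n := by
  have hn1 : (1 : ℝ) ≤ n := by exact_mod_cast hn
  -- A decay of order `n⁻²` suffices: the norm bound costs a factor `n` and leaves `κ / (4 n)`.
  set b : ℝ := κ / (4 * n ^ 2) with hb
  have hb0 : 0 ≤ b := by positivity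
  have hK : ∀ i j, i ≠ j → |K i j| ≤ b := by
    intro i j hij
    rw [hb, le_div_iff₀ (by positivity)]
    calc |K i j| * (4 * (n : ℝ) ^ 2) ≤ |K i j| * (4 * (n : ℝ) ^ 4) := by
          gcongr
          norm_num
      _ ≤ κ := by linarith [hoff i j hij]
  have hnb : n * b = κ / (4 * n) := by rw [hb]; field_simp
  have hnb' : n * b ≤ κ / 4 := by
    rw [hnb]
    gcongr
    linarith
  have h1 : ‖K - κ • 1‖ ≤ n * b := by
    refine Matrix.l2_opNorm_le_card_mul hb0 fun i j => ?_
    by_cases hij : i = j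
    · subst hij; simpa [hdiag] using hb0
    · simpa [hij] using hK i j hij
  have h2 : ‖sparsify K S - κ • 1‖ ≤ n * b := by
    refine Matrix.l2_opNorm_le_card_mul hb0 fun i j => ?_
    by_cases hij : i = j
    · subst hij; simpa [sparsify, hdiag] using hb0
    · by_cases hS : j ∈ S i
      · simpa [sparsify, hij, hS] using hK i j hij
      · simpa [sparsify, hij, Ne.symm hij, hS] using hb0
  have h3 : ‖K - sparsify K S‖ ≤ n * b := by
    refine Matrix.l2_opNorm_le_card_mul hb0 fun i j => ?_
    by_cases hS : j = i ∨ j ∈ S i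
    · simpa [sparsify, hS] using hb0
    · have hij : i ≠ j := fun h => hS (Or.inl h.symm)
      simpa [sparsify, hS] using hK i j hij
  obtain ⟨hU1, -⟩ := Matrix.isUnit_of_norm_sub_smul_one_le hκ (h1.trans hnb')
  obtain ⟨hU2, h4⟩ := Matrix.isUnit_of_norm_sub_smul_one_le hκ (h2.trans hnb')
  refine ⟨hU1, hU2, div_le_of_le_mul₀ (norm_nonneg _) (by positivity) ?_⟩
  -- The resolvent identity leaves `‖K⁻¹‖` as a factor, so only the inverse of the sparsified matrix
  -- needs a norm bound.
  have h5 : (sparsify K S)⁻¹ - K⁻¹ = (sparsify K S)⁻¹ * (K - sparsify K S) * K⁻¹ := by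
    rw [mul_sub, sub_mul, mul_assoc,
      Matrix.mul_nonsing_inv _ ((Matrix.isUnit_iff_isUnit_det K).1 hU1),
      Matrix.nonsing_inv_mul _ ((Matrix.isUnit_iff_isUnit_det _).1 hU2), mul_one, one_mul]
  rw [h5]
  calc ‖(sparsify K S)⁻¹ * (K - sparsify K S) * K⁻¹‖
      ≤ ‖(sparsify K S)⁻¹‖ * ‖K - sparsify K S‖ * ‖K⁻¹‖ :=
        (norm_mul_le _ _).trans (mul_le_mul_of_nonneg_right (norm_mul_le _ _) (norm_nonneg _))
    _ ≤ 2 / κ * (κ / (4 * n)) * ‖K⁻¹‖ := by rw [← hnb]; gcongr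
    _ = (1 / n : ℝ) / 2 * ‖K⁻¹‖ := by field_simp; norm_num
    _ ≤ 1 / n * ‖K⁻¹‖ :=
        mul_le_mul_of_nonneg_right (half_le_self (by positivity)) (norm_nonneg _)

theorem mainTheorem1 (s : ℕ → ℕ)
    (hs : (fun n : ℕ => (s n : ℝ)) =O[atTop] fun n : ℕ => Real.log (n : ℝ)) :
    ∃ C : ℝ, 0 < C ∧
      ∀ (σ : ℝ → ℝ), IsNormalizedActivation σ → 0 < nonlinCoeff σ →
      ∀ (n d : ℕ), 1 ≤ n →
      ∀ (x : Fin n → EuclideanSpace ℝ (Fin d)) (δ : ℝ), 0 < δ → δ ≤ 1 →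
        (∀ i, ‖x i‖ = 1) →
        (∀ i j, i ≠ j → |inner ℝ (x i) (x j)| ≤ 1 - δ) →
      ∀ (L τ : ℕ), convDepth n δ (nonlinCoeff σ) ≤ (L : ℝ) → (τ = 0 ∨ τ = 1) →
      ∀ (S : Fin n → Finset (Fin n)), (∀ i, (S i).card ≤ s n) →
        IsUnit (ntkMatrix σ τ L x) ∧
        IsUnit (sparsify (ntkMatrix σ τ L x) S) ∧
        ‖(sparsify (ntkMatrix σ τ L x) S)⁻¹ - (ntkMatrix σ τ L x)⁻¹‖ /
          ‖(ntkMatrix σ τ L x)⁻¹‖ ≤ C / n := by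
  refine ⟨1, one_pos, fun σ hσ hμ n d hn x δ hδ hδ1 hx hsep L τ hL _ S _ => ?_⟩
  refine isUnit_and_norm_inv_sparsify_le hn (hσ.ntkFun_one_pos hμ τ L) (fun i => ?_)
    (fun i j hij => ?_) S
  · simp [ntkMatrix, hx i]
  · exact hσ.abs_ntkFun_le_of_convDepth_le hμ hn hδ hδ1 (hsep i j hij) τ hL
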